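/- **System.** Formulas are built from atomic propositions and the units $\bot,\top$ by $\wedge,\vee,\to$ and co-implication $\phi\leftarrowtail \psi$. A formula without binary connectives has degree $0$. The bilateral natural deduction system $\mathsf{N2Int}^*$ derives proofs ($+\phi$) and refutations ($-\phi$) of formulas from assumptions (hypothetical proofs) and counterassumptions (hypothetical refutations). Its rules are as follows, where $\pm$ means that the rule exists for both kinds of conclusion, and bracketed hypotheses may be discharged. * Introduction rules: $+\top$ and $-\bot$ (no premises); from $+\psi$, discharging $[+\phi]$, infer $+(\phi\to\psi)$; from $+\phi$ and $-\psi$ infer $-(\phi\to\psi)$; from $+\phi$ and $-\psi$ infer $+(\phi\leftarrowtail \psi)$; from $-\phi$, discharging $[-\psi]$, infer $-(\phi\leftarrowtail \psi)$; from $+\phi$ and $+\psi$ infer $+(\phi\wedge\psi)$; from $-\phi$, or from $-\psi$, infer $-(\phi\wedge\psi)$; from $+\phi$, or from $+\psi$, infer $+(\phi\vee\psi)$; from $-\phi$ and $-\psi$ infer $-(\phi\vee\psi)$. * Elimination rules (major premise first): from $+(\phi\to\psi)$ and $+\phi$ infer $+\psi$; from $-(\phi\to\psi)$ infer $+\phi$,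 and infer $-\psi$; from $+(\phi\leftarrowtail \psi)$ infer $+\phi$, and infer $-\psi$; from $-(\phi\leftarrowtail \psi)$ and $-\psi$ infer $-\phi$; from $+(\phi\wedge\psi)$ infer $+\phi$, and infer $+\psi$; from $-(\phi\vee\psi)$ infer $-\phi$, and infer $-\psi$; $E\vee(+)$: from $+(\phi\vee\psi)$ and the minor premises $\pm\chi$ (discharging $[+\phi]$) and $\pm\chi$ (discharging $[+\psi]$), infer $\pm\chi$; $E\wedge(-)$: from $-(\phi\wedge\psi)$ and the minor premises $\pm\chi$ (discharging $[-\phi]$) and $\pm\chi$ (discharging $[-\psi]$), infer $\pm\chi$, the sign of $\chi$ being the same throughout an application. * $\bot(+)$: from $+\bot$ infer $\pm\phi$; $\top(-)$: from $-\top$ infer $\pm\phi$. Write $\Gamma;\Delta\vdash^{+}\phi$ (respectively $\Gamma;\Delta\vdash^{-}\phi$) if there is a derivation of $+\phi$ (respectively $-\phi$) whose undischarged assumptions are in $\Gamma$ and whose undischarged counterassumptions are in $\Delta$. **Normal form.** A *segment* is a sequence of formula occurrences $\phi_1,\dots,\phi_n$ ($n\ge1$) in a derivation such that, for every $i<n$,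 $\phi_i$ is a minor premise of an application of $E\vee(+)$ or $E\wedge(-)$ with conclusion $\phi_{i+1}$. It is *maximal* if $\phi_1$ is the conclusion of an introduction rule and $\phi_n$ is the major premise of an elimination rule. A derivation is in *normal form* if 1. all premises and conclusions of applications of $\bot(+)$ and $\top(-)$ have degree $0$, and no segment begins with the conclusion of an application of $\bot(+)$ or $\top(-)$ and ends with the premise of such an application; and 2. it has no maximal segment. **Corollary ($\mathsf{N2Int}^*$ satisfies the subformula property).** (a) Every formula that occurs in a normal derivation of $\mathsf{N2Int}^*$ is a subformula of the conclusion or of an undischarged assumption or counterassumption of that derivation. (b) For $*\in\{+,-\}$, whenever $\Gamma;\Delta\vdash^{*}\phi$ in $\mathsf{N2Int}^*$, there is a normal derivation showing $\Gamma;\Delta\vdash^{*}\phi$; in particular there is a derivation showing it in which every formula is a subformula of $\phi$ or of an undischarged assumption or counterassumption. -/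

import Mathlib

namespace N2IntStar

/-- Propositional formulas with conjunction, disjunction, implication and co-implication
(`coimp φ ψ` is `φ ↤ ψ`), over a type `At` of atomic propositions together with the units. -/
inductive Formula (At : Type*) where
  | atom (p : At)
  | bot
  | top
  | and (φ ψ : Formula At)
  | or (φ ψ : Formula At)
  | imp (φ ψ : Formula At)
  | coimp (φ ψ : Formula At)

namespace Formula

variable {At : Type*}

/-- The degree of a formula: the number of its binary connectives. -/
def degree : Formula At → ℕ
  | atom _ => 0
  | bot => 0
  | top => 0
  | and φ ψ => φ.degree + ψ.degree + 1
  | or φ ψ => φ.degree + ψ.degree + 1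
  | imp φ ψ => φ.degree + ψ.degree + 1
  | coimp φ ψ => φ.degree + ψ.degree + 1

/-- The set of subformulas of a formula (itself included). -/
def subformulas : Formula At → Set (Formula At)
  | atom p => {atom p}
  | bot => {bot}
  | top => {top}
  | and φ ψ => insert (and φ ψ) (φ.subformulas ∪ ψ.subformulas)
  | or φ ψ => insert (or φ ψ) (φ.subformulas ∪ ψ.subformulas)
  | imp φ ψ => insert (imp φ ψ) (φ.subformulas ∪ ψ.subformulas)
  | coimp φ ψ => insert (coimp φ ψ) (φ.subformulas ∪ ψ.subformulas)

end Formula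

/-- The two kinds of judgement: `pf` is a proof (single line) and `rf` is a refutation
(dual proof, double line). -/
inductive Mode where
  | pf
  | rf

open Formula Mode

/-- Derivation trees of the bilateral natural deduction system N2Int*. `Deriv s φ` is the type of
the trees that end in a proof (`s = pf`) or in a refutation (`s = rf`) of `φ`.
Leaves `hyp s φ n` are occurrences of the assumption (`s = pf`) or counterassumption (`s = rf`)
`φ`, marked with a label `n`. A rule that discharges carries the label of the
(possibly empty) class of leaves that it discharges; see `Deriv.openHyps`.
In `orE_pos`, `andE_neg`, `botE` and `topE` the kind `s` of the conclusion is arbitrary. -/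
inductive Deriv {At : Type*} : Mode → Formula At → Type _ where
  | hyp (s : Mode) (φ : Formula At) (n : ℕ) : Deriv s φ
  -- proof rules
  | topI_pos : Deriv pf (top : Formula At)
  | impI_pos {φ ψ : Formula At} (n : ℕ) (d : Deriv pf ψ) : Deriv pf (imp φ ψ)
  | impE_pos {φ ψ : Formula At} (d : Deriv pf (imp φ ψ)) (e : Deriv pf φ) : Deriv pf ψ
  | orI₁_pos {φ ψ : Formula At} (d : Deriv pf φ) : Deriv pf (or φ ψ)
  | orI₂_pos {φ ψ : Formula At} (d : Deriv pf ψ) : Deriv pf (or φ ψ)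
  | orE_pos {s : Mode} {φ ψ χ : Formula At} (n m : ℕ)
      (d : Deriv pf (or φ ψ)) (e₁ e₂ : Deriv s χ) : Deriv s χ
  | andI_pos {φ ψ : Formula At} (d : Deriv pf φ) (e : Deriv pf ψ) : Deriv pf (and φ ψ)
  | andE₁_pos {φ ψ : Formula At} (d : Deriv pf (and φ ψ)) : Deriv pf φ
  | andE₂_pos {φ ψ : Formula At} (d : Deriv pf (and φ ψ)) : Deriv pf ψ
  | coimpI_pos {φ ψ : Formula At} (d : Deriv pf φ) (e : Deriv rf ψ) : Deriv pf (coimp φ ψ)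
  | coimpE₁_pos {φ ψ : Formula At} (d : Deriv pf (coimp φ ψ)) : Deriv pf φ
  | coimpE₂_pos {φ ψ : Formula At} (d : Deriv pf (coimp φ ψ)) : Deriv rf ψ
  -- refutation rules
  | botI_neg : Deriv rf (bot : Formula At)
  | coimpI_neg {φ ψ : Formula At} (n : ℕ) (d : Deriv rf φ) : Deriv rf (coimp φ ψ)
  | coimpE_neg {φ ψ : Formula At} (d : Deriv rf (coimp φ ψ)) (e : Deriv rf ψ) : Deriv rf φ
  | andI₁_neg {φ ψ : Formula At} (d : Deriv rf φ) : Deriv rf (and φ ψ)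
  | andI₂_neg {φ ψ : Formula At} (d : Deriv rf ψ) : Deriv rf (and φ ψ)
  | andE_neg {s : Mode} {φ ψ χ : Formula At} (n m : ℕ)
      (d : Deriv rf (and φ ψ)) (e₁ e₂ : Deriv s χ) : Deriv s χ
  | orI_neg {φ ψ : Formula At} (d : Deriv rf φ) (e : Deriv rf ψ) : Deriv rf (or φ ψ)
  | orE₁_neg {φ ψ : Formula At} (d : Deriv rf (or φ ψ)) : Deriv rf φ
  | orE₂_neg {φ ψ : Formula At} (d : Deriv rf (or φ ψ)) : Deriv rf ψ
  | impI_neg {φ ψ : Formula At} (d : Deriv pf φ) (e : Deriv rf ψ) : Deriv rf (imp φ ψ)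
  | impE₁_neg {φ ψ : Formula At} (d : Deriv rf (imp φ ψ)) : Deriv pf φ
  | impE₂_neg {φ ψ : Formula At} (d : Deriv rf (imp φ ψ)) : Deriv rf ψ
  -- the rules `⊥(+)` and `⊤(-)`
  | botE {s : Mode} {φ : Formula At} (d : Deriv pf (bot : Formula At)) : Deriv s φ
  | topE {s : Mode} {φ : Formula At} (d : Deriv rf (top : Formula At)) : Deriv s φ

/-- A derivation of any kind, of any formula. Relative to a given derivation, its
subderivations stand for the formula occurrences in it (each occurrence being the conclusion of
the subtree above it). -/
structure AnyDeriv (At : Type*) where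
  mode : Mode
  formula : Formula At
  deriv : Deriv mode formula

namespace Deriv

variable {At : Type*}

/-- The undischarged leaves: triples (kind, formula, label). -/
def openHyps : {s : Mode} → {φ : Formula At} → Deriv s φ → Set (Mode × Formula At × ℕ)
  | _, _, hyp s φ n => {(s, φ, n)}
  | _, _, topI_pos => ∅
  | _, _, impI_pos (φ := φ) n d => d.openHyps \ {(pf, φ, n)}
  | _, _, impE_pos d e => d.openHyps ∪ e.openHyps
  | _, _, orI₁_pos d => d.openHyps
  | _, _, orI₂_pos d => d.openHyps
  | _, _, orE_pos (φ := φ) (ψ := ψ) n m d e₁ e₂ =>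
      d.openHyps ∪ (e₁.openHyps \ {(pf, φ, n)}) ∪ (e₂.openHyps \ {(pf, ψ, m)})
  | _, _, andI_pos d e => d.openHyps ∪ e.openHyps
  | _, _, andE₁_pos d => d.openHyps
  | _, _, andE₂_pos d => d.openHyps
  | _, _, coimpI_pos d e => d.openHyps ∪ e.openHyps
  | _, _, coimpE₁_pos d => d.openHyps
  | _, _, coimpE₂_pos d => d.openHyps
  | _, _, botI_neg => ∅
  | _, _, coimpI_neg (ψ := ψ) n d => d.openHyps \ {(rf, ψ, n)}
  | _, _, coimpE_neg d e => d.openHyps ∪ e.openHyps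
  | _, _, andI₁_neg d => d.openHyps
  | _, _, andI₂_neg d => d.openHyps
  | _, _, andE_neg (φ := φ) (ψ := ψ) n m d e₁ e₂ =>
      d.openHyps ∪ (e₁.openHyps \ {(rf, φ, n)}) ∪ (e₂.openHyps \ {(rf, ψ, m)})
  | _, _, orI_neg d e => d.openHyps ∪ e.openHyps
  | _, _, orE₁_neg d => d.openHyps
  | _, _, orE₂_neg d => d.openHyps
  | _, _, impI_neg d e => d.openHyps ∪ e.openHyps
  | _, _, impE₁_neg d => d.openHyps
  | _, _, impE₂_neg d => d.openHyps
  | _, _, botE d => d.openHyps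
  | _, _, topE d => d.openHyps

/-- The formulas that a derivation leaves undischarged as (proof) assumptions. -/
def assumptions {s : Mode} {φ : Formula At} (d : Deriv s φ) : Set (Formula At) :=
  {ψ | ∃ n, (pf, ψ, n) ∈ d.openHyps}

/-- The formulas that a derivation leaves undischarged as counterassumptions. -/
def counterassumptions {s : Mode} {φ : Formula At} (d : Deriv s φ) : Set (Formula At) :=
  {ψ | ∃ n, (rf, ψ, n) ∈ d.openHyps}

/-- The immediate subderivations, that is, the premises of the last rule application. -/
def premises : {s : Mode} → {φ : Formula At} → Deriv s φ → List (AnyDeriv At)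
  | _, _, hyp _ _ _ => []
  | _, _, topI_pos => []
  | _, _, impI_pos _ d => [⟨_, _, d⟩]
  | _, _, impE_pos d e => [⟨_, _, d⟩, ⟨_, _, e⟩]
  | _, _, orI₁_pos d => [⟨_, _, d⟩]
  | _, _, orI₂_pos d => [⟨_, _, d⟩]
  | _, _, orE_pos _ _ d e₁ e₂ => [⟨_, _, d⟩, ⟨_, _, e₁⟩, ⟨_, _, e₂⟩]
  | _, _, andI_pos d e => [⟨_, _, d⟩, ⟨_, _, e⟩]
  | _, _, andE₁_pos d => [⟨_, _, d⟩]
  | _, _, andE₂_pos d => [⟨_, _, d⟩]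
  | _, _, coimpI_pos d e => [⟨_, _, d⟩, ⟨_, _, e⟩]
  | _, _, coimpE₁_pos d => [⟨_, _, d⟩]
  | _, _, coimpE₂_pos d => [⟨_, _, d⟩]
  | _, _, botI_neg => []
  | _, _, coimpI_neg _ d => [⟨_, _, d⟩]
  | _, _, coimpE_neg d e => [⟨_, _, d⟩, ⟨_, _, e⟩]
  | _, _, andI₁_neg d => [⟨_, _, d⟩]
  | _, _, andI₂_neg d => [⟨_, _, d⟩]
  | _, _, andE_neg _ _ d e₁ e₂ => [⟨_, _, d⟩, ⟨_, _, e₁⟩, ⟨_, _, e₂⟩]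
  | _, _, orI_neg d e => [⟨_, _, d⟩, ⟨_, _, e⟩]
  | _, _, orE₁_neg d => [⟨_, _, d⟩]
  | _, _, orE₂_neg d => [⟨_, _, d⟩]
  | _, _, impI_neg d e => [⟨_, _, d⟩, ⟨_, _, e⟩]
  | _, _, impE₁_neg d => [⟨_, _, d⟩]
  | _, _, impE₂_neg d => [⟨_, _, d⟩]
  | _, _, botE d => [⟨_, _, d⟩]
  | _, _, topE d => [⟨_, _, d⟩]

/-- The subderivations of a derivation (itself included). -/
def subderivations {s : Mode} {φ : Formula At} (d : Deriv s φ) : Set (AnyDeriv At) :=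
  {a | Relation.ReflTransGen (fun x y : AnyDeriv At => x ∈ y.deriv.premises) a ⟨s, φ, d⟩}

/-- The formulas that occur in a derivation. -/
def occurring {s : Mode} {φ : Formula At} (d : Deriv s φ) : Set (Formula At) :=
  {ψ | ∃ a ∈ d.subderivations, a.formula = ψ}

/-- The last rule is an introduction rule. -/
def EndsInIntro : {s : Mode} → {φ : Formula At} → Deriv s φ → Prop
  | _, _, topI_pos => True
  | _, _, impI_pos _ _ => True
  | _, _, orI₁_pos _ => True
  | _, _, orI₂_pos _ => True
  | _, _, andI_pos _ _ => True
  | _, _, coimpI_pos _ _ => True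
  | _, _, botI_neg => True
  | _, _, coimpI_neg _ _ => True
  | _, _, andI₁_neg _ => True
  | _, _, andI₂_neg _ => True
  | _, _, orI_neg _ _ => True
  | _, _, impI_neg _ _ => True
  | _, _, _ => False

/-- The major premise of the last rule, if that is an elimination rule
(the rules `⊥(+)` and `⊤(-)` do not count as elimination rules). -/
def majorPremise : {s : Mode} → {φ : Formula At} → Deriv s φ → Option (AnyDeriv At)
  | _, _, impE_pos d _ => some ⟨_, _, d⟩
  | _, _, orE_pos _ _ d _ _ => some ⟨_, _, d⟩
  | _, _, andE₁_pos d => some ⟨_, _, d⟩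
  | _, _, andE₂_pos d => some ⟨_, _, d⟩
  | _, _, coimpE₁_pos d => some ⟨_, _, d⟩
  | _, _, coimpE₂_pos d => some ⟨_, _, d⟩
  | _, _, coimpE_neg d _ => some ⟨_, _, d⟩
  | _, _, andE_neg _ _ d _ _ => some ⟨_, _, d⟩
  | _, _, orE₁_neg d => some ⟨_, _, d⟩
  | _, _, orE₂_neg d => some ⟨_, _, d⟩
  | _, _, impE₁_neg d => some ⟨_, _, d⟩
  | _, _, impE₂_neg d => some ⟨_, _, d⟩
  | _, _, _ => none

/-- The premise of the last rule, if that is `⊥(+)` or `⊤(-)`. -/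
def explosionPremise : {s : Mode} → {φ : Formula At} → Deriv s φ → Option (AnyDeriv At)
  | _, _, botE d => some ⟨_, _, d⟩
  | _, _, topE d => some ⟨_, _, d⟩
  | _, _, _ => none

/-- The last rule is `⊥(+)` or `⊤(-)`. -/
def EndsInExplosion {s : Mode} {φ : Formula At} (d : Deriv s φ) : Prop :=
  d.explosionPremise.isSome

/-- The minor premises of the last rule, if that is `E∨(+)` or `E∧(-)`. -/
def minorPremises : {s : Mode} → {φ : Formula At} → Deriv s φ → List (Deriv s φ)
  | _, _, orE_pos _ _ _ e₁ e₂ => [e₁, e₂]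
  | _, _, andE_neg _ _ _ e₁ e₂ => [e₁, e₂]
  | _, _, _ => []

/-- There is a segment from (the conclusion of) `d` to (the conclusion of) `e`: a sequence
`φ₁, …, φₙ`, `n ≥ 1`, of formula occurrences from the former to the latter in which every `φᵢ`
with `i < n` is a minor premise of an application of `E∨(+)` or `E∧(-)` with conclusion `φᵢ₊₁`. -/
def Segment {s : Mode} {φ : Formula At} (d e : Deriv s φ) : Prop :=
  Relation.ReflTransGen (fun x y : Deriv s φ => x ∈ y.minorPremises) d e

/-- The derivation has a maximal segment: one that begins with the conclusion of an introduction
rule and ends with the major premise of an elimination rule. -/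
def HasMaximalSegment {s : Mode} {φ : Formula At} (d : Deriv s φ) : Prop :=
  ∃ r ∈ d.subderivations, ∃ b, r.deriv.majorPremise = some b ∧
    ∃ a : Deriv b.mode b.formula, Segment a b.deriv ∧ a.EndsInIntro

/-- Pre-normal form: the premises and conclusions of `⊥(+)` and `⊤(-)` have degree `0`, and no
segment begins with the conclusion of one of these rules and ends with the premise of one. -/
def IsPreNormal {s : Mode} {φ : Formula At} (d : Deriv s φ) : Prop :=
  ∀ r ∈ d.subderivations, ∀ b, r.deriv.explosionPremise = some b →
    r.formula.degree = 0 ∧ b.formula.degree = 0 ∧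
      ¬ ∃ a : Deriv b.mode b.formula, Segment a b.deriv ∧ a.EndsInExplosion

/-- Normal form: pre-normal and without maximal segments. -/
def IsNormal {s : Mode} {φ : Formula At} (d : Deriv s φ) : Prop :=
  d.IsPreNormal ∧ ¬ d.HasMaximalSegment

/-- The derivation depends only on assumptions in `Γ` and counterassumptions in `Δ`. -/
def DependsOn {s : Mode} {φ : Formula At} (d : Deriv s φ) (Γ Δ : Set (Formula At)) : Prop :=
  d.assumptions ⊆ Γ ∧ d.counterassumptions ⊆ Δ

/-- Every formula that occurs in the derivation is a subformula of the conclusion or of an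
undischarged assumption or counterassumption. -/
def HasSubformulaProperty {s : Mode} {φ : Formula At} (d : Deriv s φ) : Prop :=
  ∀ ψ ∈ d.occurring, ψ ∈ φ.subformulas ∨
    ∃ χ ∈ d.assumptions ∪ d.counterassumptions, ψ ∈ χ.subformulas

end Deriv

/-- `Γ; Δ ⊢⁺ φ` (for `s = pf`) and `Γ; Δ ⊢⁻ φ` (for `s = rf`) in N2Int*. -/
def Derives {At : Type*} (Γ Δ : Set (Formula At)) (s : Mode) (φ : Formula At) : Prop :=
  ∃ d : Deriv s φ, d.DependsOn Γ Δ

end N2IntStar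

/-! Part (a) is an induction on the derivation, with a strengthened claim (`IsBounded`): if no
segment ending at the conclusion begins with an introduction or an explosion (`IsAnalytic`), then
the undischarged hypotheses alone account for all formulas. In a normal derivation every major
premise is analytic: there is no maximal segment, and explosions conclude only formulas of degree 0,
whereas major premises are compound. Premises of explosions are analytic too, because no
introduction proves `⊥` or refutes `⊤`. Hence what an elimination yields or discharges lies below
the open hypotheses (`IsNormal.isBounded`).

Part (b) avoids reduction sequences and normalizes by evaluation. The worlds of a Beth-style model
are contexts of signed formulas, and an atom is forced where it has a normal derivation. Proofs of
disjunctions and refutations of conjunctions are forced up to a finite tree of case distinctions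
(`Cov`). Forcing is persistent and local (`Forces.mono`, `Forces.of_cov`), so all rules are sound
(`Deriv.forces`). Neutral derivability implies forcing, which implies normal derivability
(`Forces.reflect_reify`). Every hypothesis is forced at its own context, hence so is the conclusion,
and a normal derivation is read off. -/

namespace N2IntStar

open Formula Mode

variable {At : Type*}

/-! ### Subformulas -/

namespace Formula

theorem mem_subformulas_self (φ : Formula At) : φ ∈ φ.subformulas := by
  cases φ <;> simp [subformulas]

theorem subformulas_subset {φ ψ : Formula At} (h : φ ∈ ψ.subformulas) :
    φ.subformulas ⊆ ψ.subformulas := by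
  induction ψ with
  | atom p => obtain rfl := h; exact subset_rfl
  | bot => obtain rfl := h; exact subset_rfl
  | top => obtain rfl := h; exact subset_rfl
  | and α β ihα ihβ | or α β ihα ihβ | imp α β ihα ihβ | coimp α β ihα ihβ =>
    rcases h with rfl | h | h
    · exact subset_rfl
    · exact fun _ hx => Or.inr (Or.inl (ihα h hx))
    · exact fun _ hx => Or.inr (Or.inr (ihβ h hx))

theorem mem_subformulas_left (φ ψ : Formula At) :
    φ ∈ (and φ ψ).subformulas ∧ φ ∈ (or φ ψ).subformulas ∧
      φ ∈ (imp φ ψ).subformulas ∧ φ ∈ (coimp φ ψ).subformulas := by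
  simp [subformulas, mem_subformulas_self]

theorem mem_subformulas_right (φ ψ : Formula At) :
    ψ ∈ (and φ ψ).subformulas ∧ ψ ∈ (or φ ψ).subformulas ∧
      ψ ∈ (imp φ ψ).subformulas ∧ ψ ∈ (coimp φ ψ).subformulas := by
  simp [subformulas, mem_subformulas_self]

end Formula

/-! ### The subformula property of normal derivations -/

namespace Deriv

variable {s : Mode} {φ : Formula At}

/-- The conditions that normality imposes on the last rule application. -/
def IsNormalAtRoot (d : Deriv s φ) : Prop :=
  (∀ b, d.explosionPremise = some b → φ.degree = 0 ∧ b.formula.degree = 0 ∧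
    ¬ ∃ a : Deriv b.mode b.formula, Segment a b.deriv ∧ a.EndsInExplosion) ∧
  ∀ b, d.majorPremise = some b →
    ¬ ∃ a : Deriv b.mode b.formula, Segment a b.deriv ∧ a.EndsInIntro

theorem mem_subderivations_iff {d : Deriv s φ} {a : AnyDeriv At} :
    a ∈ d.subderivations ↔ a = ⟨s, φ, d⟩ ∨ ∃ c ∈ d.premises, a ∈ c.deriv.subderivations := by
  constructor
  · intro h
    rcases Relation.ReflTransGen.cases_tail h with h | ⟨c, hac, hc⟩
    · exact Or.inl h.symm
    · exact Or.inr ⟨c, hc, hac⟩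
  · rintro (rfl | ⟨c, hc, hac⟩)
    · exact Relation.ReflTransGen.refl
    · exact Relation.ReflTransGen.tail hac hc

theorem isNormal_iff {d : Deriv s φ} :
    d.IsNormal ↔ d.IsNormalAtRoot ∧ ∀ c ∈ d.premises, c.deriv.IsNormal := by
  constructor
  · rintro ⟨h₁, h₂⟩
    refine ⟨⟨h₁ ⟨s, φ, d⟩ Relation.ReflTransGen.refl,
      fun b hb ha => h₂ ⟨_, Relation.ReflTransGen.refl, b, hb, ha⟩⟩, fun c hc => ⟨fun r hr => ?_, ?_⟩⟩
    · exact h₁ r (mem_subderivations_iff.2 (Or.inr ⟨c, hc, hr⟩))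
    · rintro ⟨r, hr, h⟩
      exact h₂ ⟨r, mem_subderivations_iff.2 (Or.inr ⟨c, hc, hr⟩), h⟩
  · rintro ⟨⟨h₁, h₂⟩, h⟩
    constructor
    · intro r hr
      rcases mem_subderivations_iff.1 hr with rfl | ⟨c, hc, hr⟩
      · exact h₁
      · exact (h c hc).1 r hr
    · rintro ⟨r, hr, b, hb, ha⟩
      rcases mem_subderivations_iff.1 hr with rfl | ⟨c, hc, hr⟩
      · exact h₂ b hb ha
      · exact (h c hc).2 ⟨r, hr, b, hb, ha⟩

theorem mem_occurring_iff {d : Deriv s φ} {ψ : Formula At} :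
    ψ ∈ d.occurring ↔ ψ = φ ∨ ∃ c ∈ d.premises, ψ ∈ c.deriv.occurring := by
  constructor
  · rintro ⟨a, ha, rfl⟩
    rcases mem_subderivations_iff.1 ha with rfl | ⟨c, hc, ha⟩
    · exact Or.inl rfl
    · exact Or.inr ⟨c, hc, a, ha, rfl⟩
  · rintro (rfl | ⟨c, hc, a, ha, rfl⟩)
    · exact ⟨_, Relation.ReflTransGen.refl, rfl⟩
    · exact ⟨a, mem_subderivations_iff.2 (Or.inr ⟨c, hc, ha⟩), rfl⟩

/-- No segment that ends with the conclusion of the derivation begins with the conclusion of an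
introduction rule or of one of the rules `⊥(+)` and `⊤(-)`. -/
def IsAnalytic (d : Deriv s φ) : Prop :=
  ∀ a : Deriv s φ, Segment a d → ¬ a.EndsInIntro ∧ ¬ a.EndsInExplosion

theorem IsAnalytic.minorPremise {d e : Deriv s φ} (h : d.IsAnalytic) (he : e ∈ d.minorPremises) :
    e.IsAnalytic :=
  fun a ha => h a (Relation.ReflTransGen.tail ha he)

theorem IsNormal.of_segment {a d : Deriv s φ} (hd : d.IsNormal) (h : Segment a d) :
    a.IsNormal := by
  induction h using Relation.ReflTransGen.head_induction_on with
  | refl => exact hd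
  | @head a c hac _ ih =>
    refine (isNormal_iff.1 ih).2 ⟨_, _, a⟩ ?_
    cases c <;> simp_all [minorPremises, premises]

theorem IsNormal.degree_eq_zero {d : Deriv s φ} (hd : d.IsNormal) (h : d.EndsInExplosion) :
    φ.degree = 0 := by
  obtain ⟨b, hb⟩ := Option.isSome_iff_exists.1 h
  exact ((isNormal_iff.1 hd).1.1 b hb).1

/-- The formula is constant along a segment, so an explosion at its start would force degree 0, and
an introduction there would make the segment maximal. -/
theorem IsNormal.isAnalytic_majorPremise {d : Deriv s φ} (hd : d.IsNormal) {b : AnyDeriv At}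
    (hb : d.majorPremise = some b) (hn : b.deriv.IsNormal) (hdeg : b.formula.degree ≠ 0) :
    b.deriv.IsAnalytic :=
  fun a ha => ⟨fun hi => (isNormal_iff.1 hd).1.2 b hb ⟨a, ha, hi⟩,
    fun he => hdeg ((hn.of_segment ha).degree_eq_zero he)⟩

theorem not_endsInIntro_bot (d : Deriv pf (bot : Formula At)) : ¬ d.EndsInIntro := by
  cases d <;> simp [EndsInIntro]

theorem not_endsInIntro_top (d : Deriv rf (top : Formula At)) : ¬ d.EndsInIntro := by
  cases d <;> simp [EndsInIntro]

/-- The subformulas of the undischarged assumptions and counterassumptions. -/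
def hypSubformulas (d : Deriv s φ) : Set (Formula At) :=
  {ψ | ∃ h ∈ d.openHyps, ψ ∈ h.2.1.subformulas}

theorem subformulas_subset_hypSubformulas {d : Deriv s φ} {ψ : Formula At}
    (h : ψ ∈ d.hypSubformulas) : ψ.subformulas ⊆ d.hypSubformulas := by
  obtain ⟨x, hx, h⟩ := h
  exact fun _ h' => ⟨x, hx, subformulas_subset h h'⟩

theorem hypSubformulas_mono {t : Mode} {ψ : Formula At} {d : Deriv s φ} {e : Deriv t ψ}
    (h : d.openHyps ⊆ e.openHyps) : d.hypSubformulas ⊆ e.hypSubformulas :=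
  fun _ ⟨x, hx, h'⟩ => ⟨x, h hx, h'⟩

theorem hypSubformulas_subset_of_discharge {t u : Mode} {ψ χ : Formula At} {n : ℕ}
    {d : Deriv s φ} {e : Deriv t ψ} (h : d.openHyps \ {(u, χ, n)} ⊆ e.openHyps) :
    d.hypSubformulas ⊆ χ.subformulas ∪ e.hypSubformulas := by
  rintro α ⟨x, hx, hα⟩
  by_cases hxe : x = (u, χ, n)
  · subst hxe; exact Or.inl hα
  · exact Or.inr ⟨x, h ⟨hx, hxe⟩, hα⟩

/-- The formulas of a derivation are subformulas of the conclusion or of open hypotheses, and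
the conclusion is not needed if the derivation is analytic. -/
def IsBounded (d : Deriv s φ) : Prop :=
  d.occurring ⊆ φ.subformulas ∪ d.hypSubformulas ∧
    (d.IsAnalytic → d.occurring ⊆ d.hypSubformulas)

/-- In the analytic case it suffices to place the conclusion below the hypotheses, since its
subformulas then follow. -/
theorem IsBounded.of_premises {d : Deriv s φ}
    (h : ∀ c ∈ d.premises, c.deriv.occurring ⊆ φ.subformulas ∪ d.hypSubformulas)
    (hA : d.IsAnalytic → φ ∈ d.hypSubformulas) : d.IsBounded := by
  have h₁ : d.occurring ⊆ φ.subformulas ∪ d.hypSubformulas := by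
    intro ψ hψ
    rcases mem_occurring_iff.1 hψ with rfl | ⟨c, hc, hψ⟩
    · exact Or.inl (mem_subformulas_self _)
    · exact h c hc hψ
  exact ⟨h₁, fun ha => h₁.trans (Set.union_subset (subformulas_subset_hypSubformulas (hA ha))
    subset_rfl)⟩

/-- The analytic half is vacuous: the one-element segment already begins with an introduction. -/
theorem isBounded_of_endsInIntro {d : Deriv s φ} (hd : d.EndsInIntro)
    (h : ∀ c ∈ d.premises, c.deriv.occurring ⊆ φ.subformulas ∪ d.hypSubformulas) :
    d.IsBounded :=
  .of_premises h fun ha => absurd hd (ha d .refl).1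

theorem mem_occurring_self (d : Deriv s φ) : φ ∈ d.occurring :=
  mem_occurring_iff.2 (Or.inl rfl)

/-- A premise above which nothing is discharged. -/
theorem IsBounded.occurring_subset {t : Mode} {ψ : Formula At} {c : Deriv t ψ} {d : Deriv s φ}
    (hc : c.IsBounded) (hψ : ψ ∈ φ.subformulas ∪ d.hypSubformulas)
    (h : c.openHyps ⊆ d.openHyps) : c.occurring ⊆ φ.subformulas ∪ d.hypSubformulas := by
  refine hc.1.trans (Set.union_subset ?_ ((hypSubformulas_mono h).trans Set.subset_union_right))
  rcases hψ with hψ | hψ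
  · exact (subformulas_subset hψ).trans Set.subset_union_left
  · exact (subformulas_subset_hypSubformulas hψ).trans Set.subset_union_right

/-- A premise above which `χ` is discharged. -/
theorem IsBounded.occurring_subset_of_discharge {t u : Mode} {ψ χ : Formula At} {n : ℕ}
    {c : Deriv t ψ} {d : Deriv s φ} (hc : c.IsBounded) (hψ : ψ ∈ φ.subformulas)
    (hχ : χ ∈ φ.subformulas ∪ d.hypSubformulas) (h : c.openHyps \ {(u, χ, n)} ⊆ d.openHyps) :
    c.occurring ⊆ φ.subformulas ∪ d.hypSubformulas := by
  refine hc.1.trans (Set.union_subset ((subformulas_subset hψ).trans Set.subset_union_left)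
    ((hypSubformulas_subset_of_discharge h).trans
      (Set.union_subset ?_ Set.subset_union_right)))
  rcases hχ with hχ | hχ
  · exact (subformulas_subset hχ).trans Set.subset_union_left
  · exact (subformulas_subset_hypSubformulas hχ).trans Set.subset_union_right

/-- An analytic premise. -/
theorem IsBounded.occurring_subset_hypSubformulas {t : Mode} {ψ : Formula At} {c : Deriv t ψ}
    {d : Deriv s φ} (hc : c.IsBounded) (ha : c.IsAnalytic) (h : c.openHyps ⊆ d.openHyps) :
    c.occurring ⊆ d.hypSubformulas :=
  (hc.2 ha).trans (hypSubformulas_mono h)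

/-- The rules `⊥(+)` and `⊤(-)`. -/
theorem isBounded_of_explosionPremise {d : Deriv s φ} {b : AnyDeriv At} (hd : d.IsNormal)
    (hb : d.explosionPremise = some b) (hp : d.premises = [b])
    (hi : ∀ a : Deriv b.mode b.formula, ¬ a.EndsInIntro) (ih : b.deriv.IsBounded)
    (h : b.deriv.openHyps ⊆ d.openHyps) : d.IsBounded := by
  have hroot := (isNormal_iff.1 hd).1.1 b hb
  refine .of_premises ?_ fun ha => absurd (Option.isSome_iff_exists.2 ⟨b, hb⟩) (ha d .refl).2
  intro c hc
  obtain rfl : c = b := by simpa [hp] using hc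
  exact (ih.occurring_subset_hypSubformulas
    (fun a ha => ⟨hi a, fun he => hroot.2.2 ⟨a, ha, he⟩⟩) h).trans Set.subset_union_right

/-- Elimination rules with a single premise. -/
theorem isBounded_of_majorPremise {d : Deriv s φ} {b : AnyDeriv At} (hd : d.IsNormal)
    (hb : d.majorPremise = some b) (hp : d.premises = [b]) (hdeg : b.formula.degree ≠ 0)
    (hφ : φ ∈ b.formula.subformulas) (ih : b.deriv.IsBounded)
    (h : b.deriv.openHyps ⊆ d.openHyps) : d.IsBounded := by
  have hbN : b.deriv.IsNormal := (isNormal_iff.1 hd).2 b (by simp [hp])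
  -- The major premise is analytic, so its formula, and with it the conclusion, lies below the open
  -- hypotheses.
  have hocc := ih.occurring_subset_hypSubformulas (hd.isAnalytic_majorPremise hb hbN hdeg) h
  refine .of_premises ?_ fun _ => subformulas_subset_hypSubformulas (hocc (mem_occurring_self _)) hφ
  intro c hc
  obtain rfl : c = b := by simpa [hp] using hc
  exact hocc.trans Set.subset_union_right

/-- Elimination rules with a minor premise that discharge nothing. -/
theorem isBounded_of_majorPremise_of_minor {d : Deriv s φ} {b c : AnyDeriv At} (hd : d.IsNormal)
    (hb : d.majorPremise = some b) (hp : d.premises = [b, c]) (hdeg : b.formula.degree ≠ 0)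
    (hφ : φ ∈ b.formula.subformulas) (hψ : c.formula ∈ b.formula.subformulas)
    (ihb : b.deriv.IsBounded) (ihc : c.deriv.IsBounded)
    (h : d.openHyps = b.deriv.openHyps ∪ c.deriv.openHyps) : d.IsBounded := by
  have hbN : b.deriv.IsNormal := (isNormal_iff.1 hd).2 b (by simp [hp])
  have hocc := ihb.occurring_subset_hypSubformulas (hd.isAnalytic_majorPremise hb hbN hdeg)
    (d := d) (h ▸ Set.subset_union_left)
  have hsub := subformulas_subset_hypSubformulas (hocc (mem_occurring_self _))
  refine .of_premises ?_ fun _ => hsub hφ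
  intro x hx
  obtain rfl | rfl : x = b ∨ x = c := by simpa [hp] using hx
  · exact hocc.trans Set.subset_union_right
  · exact ihc.occurring_subset (Or.inr (hsub hψ)) (h ▸ Set.subset_union_right)

/-- The rules `E∨(+)` and `E∧(-)`. -/
theorem isBounded_of_minorPremises {d e₁ e₂ : Deriv s φ} {b : AnyDeriv At} {t : Mode}
    {α β : Formula At} {n m : ℕ} (hd : d.IsNormal)
    (hb : d.majorPremise = some b) (hp : d.premises = [b, ⟨s, φ, e₁⟩, ⟨s, φ, e₂⟩])
    (hm : d.minorPremises = [e₁, e₂]) (hdeg : b.formula.degree ≠ 0)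
    (hα : α ∈ b.formula.subformulas) (hβ : β ∈ b.formula.subformulas)
    (ihb : b.deriv.IsBounded) (ih₁ : e₁.IsBounded) (ih₂ : e₂.IsBounded)
    (h : d.openHyps = b.deriv.openHyps ∪ (e₁.openHyps \ {(t, α, n)}) ∪
      (e₂.openHyps \ {(t, β, m)})) : d.IsBounded := by
  have hbN : b.deriv.IsNormal := (isNormal_iff.1 hd).2 b (by simp [hp])
  have hocc := ihb.occurring_subset_hypSubformulas (hd.isAnalytic_majorPremise hb hbN hdeg)
    (d := d) (h ▸ Set.subset_union_left.trans Set.subset_union_left)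
  have hsub := subformulas_subset_hypSubformulas (hocc (mem_occurring_self _))
  have h₁ : e₁.openHyps \ {(t, α, n)} ⊆ d.openHyps :=
    h ▸ Set.subset_union_right.trans Set.subset_union_left
  have h₂ : e₂.openHyps \ {(t, β, m)} ⊆ d.openHyps := h ▸ Set.subset_union_right
  refine .of_premises ?_ fun ha => ?_
  · intro x hx
    obtain rfl | rfl | rfl : x = b ∨ x = ⟨s, φ, e₁⟩ ∨ x = ⟨s, φ, e₂⟩ := by simpa [hp] using hx
    · exact hocc.trans Set.subset_union_right
    · exact ih₁.occurring_subset_of_discharge (mem_subformulas_self _) (Or.inr (hsub hα)) h₁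
    · exact ih₂.occurring_subset_of_discharge (mem_subformulas_self _) (Or.inr (hsub hβ)) h₂
  -- Analyticity passes up to the minor premise, which has the same formula. That formula lies below
  -- an open hypothesis, or below the discharged `α`, itself a subformula of the major premise.
  · have hφ := ih₁.2 (ha.minorPremise (by simp [hm])) (mem_occurring_self _)
    exact (hypSubformulas_subset_of_discharge h₁ hφ).elim
      (fun hφ => subformulas_subset_hypSubformulas (hsub hα) hφ) id

theorem IsNormal.isBounded {d : Deriv s φ} (hd : d.IsNormal) : d.IsBounded := by
  have hprem := (isNormal_iff.1 hd).2
  have L := @mem_subformulas_left At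
  have R := @mem_subformulas_right At
  induction d with
  | hyp s φ n =>
    exact .of_premises (by simp [premises]) fun _ => ⟨_, rfl, mem_subformulas_self _⟩
  | topI_pos => exact isBounded_of_endsInIntro trivial (by simp [premises])
  | botI_neg => exact isBounded_of_endsInIntro trivial (by simp [premises])
  | impI_pos n d ih =>
    simp only [premises, List.mem_singleton, forall_eq] at hprem
    refine isBounded_of_endsInIntro trivial ?_
    simp only [premises, List.mem_singleton, forall_eq]
    exact (ih hprem (isNormal_iff.1 hprem).2).occurring_subset_of_discharge (R _ _).2.2.1
      (Or.inl (L _ _).2.2.1) subset_rfl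
  | coimpI_neg n d ih =>
    simp only [premises, List.mem_singleton, forall_eq] at hprem
    refine isBounded_of_endsInIntro trivial ?_
    simp only [premises, List.mem_singleton, forall_eq]
    exact (ih hprem (isNormal_iff.1 hprem).2).occurring_subset_of_discharge (L _ _).2.2.2
      (Or.inl (R _ _).2.2.2) subset_rfl
  | orI₁_pos d ih | orI₂_pos d ih | andI₁_neg d ih | andI₂_neg d ih =>
    simp only [premises, List.mem_singleton, forall_eq] at hprem
    refine isBounded_of_endsInIntro trivial ?_
    simp only [premises, List.mem_singleton, forall_eq]
    exact (ih hprem (isNormal_iff.1 hprem).2).occurring_subset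
      (Or.inl (by simp [L, R])) subset_rfl
  | andI_pos d e ihd ihe | coimpI_pos d e ihd ihe | orI_neg d e ihd ihe
  | impI_neg d e ihd ihe =>
    simp only [premises, List.mem_cons, List.not_mem_nil, or_false, forall_eq_or_imp,
      forall_eq] at hprem
    refine isBounded_of_endsInIntro trivial ?_
    simp only [premises, List.mem_cons, List.not_mem_nil, or_false, forall_eq_or_imp, forall_eq]
    exact ⟨(ihd hprem.1 (isNormal_iff.1 hprem.1).2).occurring_subset
        (Or.inl (by simp [L])) Set.subset_union_left,
      (ihe hprem.2 (isNormal_iff.1 hprem.2).2).occurring_subset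
        (Or.inl (by simp [R])) Set.subset_union_right⟩
  | andE₁_pos d ih | andE₂_pos d ih | coimpE₁_pos d ih | coimpE₂_pos d ih | orE₁_neg d ih
  | orE₂_neg d ih | impE₁_neg d ih | impE₂_neg d ih =>
    simp only [premises, List.mem_singleton, forall_eq] at hprem
    exact isBounded_of_majorPremise hd rfl rfl (by simp [degree]) (by simp [L, R])
      (ih hprem (isNormal_iff.1 hprem).2) subset_rfl
  | impE_pos d e ihd ihe | coimpE_neg d e ihd ihe =>
    simp only [premises, List.mem_cons, List.not_mem_nil, or_false, forall_eq_or_imp,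
      forall_eq] at hprem
    exact isBounded_of_majorPremise_of_minor hd rfl rfl (by simp [degree]) (by simp [L, R])
      (by simp [L, R]) (ihd hprem.1 (isNormal_iff.1 hprem.1).2)
      (ihe hprem.2 (isNormal_iff.1 hprem.2).2) rfl
  | orE_pos n m d e₁ e₂ ihd ih₁ ih₂ | andE_neg n m d e₁ e₂ ihd ih₁ ih₂ =>
    simp only [premises, List.mem_cons, List.not_mem_nil, or_false, forall_eq_or_imp,
      forall_eq] at hprem
    obtain ⟨hd', h₁, h₂⟩ := hprem
    refine isBounded_of_minorPremises hd rfl rfl rfl (by simp [degree]) ?_ ?_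
      (ihd hd' (isNormal_iff.1 hd').2) (ih₁ h₁ (isNormal_iff.1 h₁).2)
      (ih₂ h₂ (isNormal_iff.1 h₂).2) rfl <;> simp [L, R]
  | botE d ih =>
    simp only [premises, List.mem_singleton, forall_eq] at hprem
    exact isBounded_of_explosionPremise hd rfl rfl not_endsInIntro_bot
      (ih hprem (isNormal_iff.1 hprem).2) subset_rfl
  | topE d ih =>
    simp only [premises, List.mem_singleton, forall_eq] at hprem
    exact isBounded_of_explosionPremise hd rfl rfl not_endsInIntro_top
      (ih hprem (isNormal_iff.1 hprem).2) subset_rfl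

theorem IsNormal.hasSubformulaProperty {d : Deriv s φ} (hd : d.IsNormal) :
    d.HasSubformulaProperty := by
  intro ψ hψ
  rcases hd.isBounded.1 hψ with h | ⟨⟨t, χ, n⟩, hx, h⟩
  · exact Or.inl h
  · cases t
    · exact Or.inr ⟨χ, Or.inl ⟨n, hx⟩, h⟩
    · exact Or.inr ⟨χ, Or.inr ⟨n, hx⟩, h⟩

end Deriv

/-! ### Neutral derivations and criteria for normality -/

namespace Deriv

variable {s : Mode} {φ : Formula At}

theorem isNormal_of_majorPremise_eq_none {d : Deriv s φ} (h₁ : d.explosionPremise = none)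
    (h₂ : d.majorPremise = none) (h : ∀ c ∈ d.premises, c.deriv.IsNormal) : d.IsNormal :=
  isNormal_iff.2 ⟨⟨by simp [h₁], by simp [h₂]⟩, h⟩

/-- A derivation whose last rule is neither an introduction rule, nor one of `⊥(+)` and `⊤(-)`,
nor one of `E∨(+)` and `E∧(-)`. -/
def IsNeutral (d : Deriv s φ) : Prop :=
  d.minorPremises = [] ∧ ¬ d.EndsInIntro ∧ ¬ d.EndsInExplosion

/-- Without minor premises, the only segment ending here is the trivial one. -/
theorem IsNeutral.isAnalytic {d : Deriv s φ} (h : d.IsNeutral) : d.IsAnalytic := by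
  intro a ha
  rcases Relation.ReflTransGen.cases_tail ha with rfl | ⟨c, -, hc⟩
  · exact h.2
  · simp [h.1] at hc

theorem isNormal_of_majorPremise_eq_some {d : Deriv s φ} {b : AnyDeriv At}
    (h₁ : d.explosionPremise = none) (h₂ : d.majorPremise = some b) (hb : b.deriv.IsNeutral)
    (h : ∀ c ∈ d.premises, c.deriv.IsNormal) : d.IsNormal := by
  refine isNormal_iff.2 ⟨⟨by simp [h₁], ?_⟩, h⟩
  rintro b' hb' ⟨a, ha, hi⟩
  obtain rfl : b = b' := by simpa [h₂] using hb'
  exact (hb.isAnalytic a ha).1 hi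

theorem isNormal_of_explosionPremise_eq_some {d : Deriv s φ} {b : AnyDeriv At}
    (h₁ : d.explosionPremise = some b) (h₂ : d.majorPremise = none) (hb : b.deriv.IsNeutral)
    (hφ : φ.degree = 0) (hb₀ : b.formula.degree = 0)
    (h : ∀ c ∈ d.premises, c.deriv.IsNormal) : d.IsNormal := by
  refine isNormal_iff.2 ⟨⟨?_, by simp [h₂]⟩, h⟩
  intro b' hb'
  obtain rfl : b = b' := by simpa [h₁] using hb'
  exact ⟨hφ, hb₀, fun ⟨a, ha, he⟩ => (hb.isAnalytic a ha).2 he⟩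

end Deriv

/-- Sets of signed formulas, the signs distinguishing assumptions and counterassumptions. -/
abbrev Ctx (At : Type*) := Set (Mode × Formula At)

/-- The hypotheses in `Γ`, all of them with the label `0`. -/
def Ctx.leaves (Γ : Ctx At) : Set (Mode × Formula At × ℕ) :=
  {h | (h.1, h.2.1) ∈ Γ ∧ h.2.2 = 0}

theorem Ctx.leaves_mono {Γ Γ' : Ctx At} (h : Γ ⊆ Γ') : Γ.leaves ⊆ Γ'.leaves :=
  fun _ hx => ⟨h hx.1, hx.2⟩

/-- Since all leaves carry the label `0`, discharging that label removes every occurrence of the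
signed formula, so contexts can be plain sets. -/
theorem Ctx.diff_subset_leaves {Γ : Ctx At} {s : Mode} {φ : Formula At}
    {S : Set (Mode × Formula At × ℕ)} (h : S ⊆ Ctx.leaves (insert (s, φ) Γ)) :
    S \ {(s, φ, 0)} ⊆ Γ.leaves := by
  rintro ⟨t, ψ, n⟩ ⟨hx, hne⟩
  obtain ⟨h₁, h₂⟩ := h hx
  simp only [Set.mem_insert_iff, Prod.mk.injEq, Set.mem_singleton_iff] at h₁ h₂ hne
  subst h₂
  exact ⟨h₁.resolve_left fun h' => hne ⟨h'.1, h'.2, rfl⟩, rfl⟩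

/-- There is a normal derivation from hypotheses in `Γ`. -/
def Nf (Γ : Ctx At) (s : Mode) (φ : Formula At) : Prop :=
  ∃ d : Deriv s φ, d.openHyps ⊆ Γ.leaves ∧ d.IsNormal

/-- There is a neutral normal derivation from hypotheses in `Γ`. -/
def Ne (Γ : Ctx At) (s : Mode) (φ : Formula At) : Prop :=
  ∃ d : Deriv s φ, d.openHyps ⊆ Γ.leaves ∧ d.IsNormal ∧ d.IsNeutral

variable {Γ Γ' : Ctx At} {s : Mode} {φ ψ χ : Formula At}

theorem Nf.mono (h : Γ ⊆ Γ') : Nf Γ s φ → Nf Γ' s φ :=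
  fun ⟨d, hd, hn⟩ => ⟨d, hd.trans (Ctx.leaves_mono h), hn⟩

theorem Ne.mono (h : Γ ⊆ Γ') : Ne Γ s φ → Ne Γ' s φ :=
  fun ⟨d, hd, hn⟩ => ⟨d, hd.trans (Ctx.leaves_mono h), hn⟩

theorem Ne.nf : Ne Γ s φ → Nf Γ s φ :=
  fun ⟨d, hd, hn, _⟩ => ⟨d, hd, hn⟩

/-! ### Closure of normal and neutral derivability under the rules -/

section Rules

open Deriv

theorem Ne.hyp (h : (s, φ) ∈ Γ) : Ne Γ s φ :=
  ⟨.hyp s φ 0, by rintro _ rfl; exact ⟨h, rfl⟩,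
    isNormal_of_majorPremise_eq_none rfl rfl (by simp [premises]),
    rfl, by simp [EndsInIntro], by simp [EndsInExplosion, explosionPremise]⟩

theorem Nf.topI_pos : Nf Γ pf (top : Formula At) :=
  ⟨.topI_pos, by simp [openHyps], isNormal_of_majorPremise_eq_none rfl rfl (by simp [premises])⟩

theorem Nf.botI_neg : Nf Γ rf (bot : Formula At) :=
  ⟨.botI_neg, by simp [openHyps], isNormal_of_majorPremise_eq_none rfl rfl (by simp [premises])⟩

theorem Nf.impI_pos : Nf (insert (pf, φ) Γ) pf ψ → Nf Γ pf (imp φ ψ) :=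
  fun ⟨d, hd, hn⟩ => ⟨.impI_pos 0 d, Ctx.diff_subset_leaves hd,
    isNormal_of_majorPremise_eq_none rfl rfl (by simpa [premises] using hn)⟩

theorem Nf.coimpI_neg : Nf (insert (rf, ψ) Γ) rf φ → Nf Γ rf (coimp φ ψ) :=
  fun ⟨d, hd, hn⟩ => ⟨.coimpI_neg 0 d, Ctx.diff_subset_leaves hd,
    isNormal_of_majorPremise_eq_none rfl rfl (by simpa [premises] using hn)⟩

theorem Nf.impI_neg : Nf Γ pf φ → Nf Γ rf ψ → Nf Γ rf (imp φ ψ) :=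
  fun ⟨d, hd, hn⟩ ⟨e, he, hm⟩ => ⟨.impI_neg d e, Set.union_subset hd he,
    isNormal_of_majorPremise_eq_none rfl rfl (by simpa [premises] using ⟨hn, hm⟩)⟩

theorem Nf.coimpI_pos : Nf Γ pf φ → Nf Γ rf ψ → Nf Γ pf (coimp φ ψ) :=
  fun ⟨d, hd, hn⟩ ⟨e, he, hm⟩ => ⟨.coimpI_pos d e, Set.union_subset hd he,
    isNormal_of_majorPremise_eq_none rfl rfl (by simpa [premises] using ⟨hn, hm⟩)⟩

theorem Nf.andI_pos : Nf Γ pf φ → Nf Γ pf ψ → Nf Γ pf (and φ ψ) :=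
  fun ⟨d, hd, hn⟩ ⟨e, he, hm⟩ => ⟨.andI_pos d e, Set.union_subset hd he,
    isNormal_of_majorPremise_eq_none rfl rfl (by simpa [premises] using ⟨hn, hm⟩)⟩

theorem Nf.orI_neg : Nf Γ rf φ → Nf Γ rf ψ → Nf Γ rf (or φ ψ) :=
  fun ⟨d, hd, hn⟩ ⟨e, he, hm⟩ => ⟨.orI_neg d e, Set.union_subset hd he,
    isNormal_of_majorPremise_eq_none rfl rfl (by simpa [premises] using ⟨hn, hm⟩)⟩

theorem Nf.orI₁_pos : Nf Γ pf φ → Nf Γ pf (or φ ψ) :=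
  fun ⟨d, hd, hn⟩ => ⟨.orI₁_pos d, hd,
    isNormal_of_majorPremise_eq_none rfl rfl (by simpa [premises] using hn)⟩

theorem Nf.orI₂_pos : Nf Γ pf ψ → Nf Γ pf (or φ ψ) :=
  fun ⟨d, hd, hn⟩ => ⟨.orI₂_pos d, hd,
    isNormal_of_majorPremise_eq_none rfl rfl (by simpa [premises] using hn)⟩

theorem Nf.andI₁_neg : Nf Γ rf φ → Nf Γ rf (and φ ψ) :=
  fun ⟨d, hd, hn⟩ => ⟨.andI₁_neg d, hd,
    isNormal_of_majorPremise_eq_none rfl rfl (by simpa [premises] using hn)⟩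

theorem Nf.andI₂_neg : Nf Γ rf ψ → Nf Γ rf (and φ ψ) :=
  fun ⟨d, hd, hn⟩ => ⟨.andI₂_neg d, hd,
    isNormal_of_majorPremise_eq_none rfl rfl (by simpa [premises] using hn)⟩

/-- Only the major premise must be neutral; the minor premise lies on no segment leading to an
elimination, so any normal derivation serves. -/
theorem Ne.impE_pos : Ne Γ pf (imp φ ψ) → Nf Γ pf φ → Ne Γ pf ψ :=
  fun ⟨d, hd, hn, hN⟩ ⟨e, he, hm⟩ => ⟨.impE_pos d e, Set.union_subset hd he,
    isNormal_of_majorPremise_eq_some rfl rfl hN (by simpa [premises] using ⟨hn, hm⟩),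
    rfl, by simp [EndsInIntro], by simp [EndsInExplosion, explosionPremise]⟩

theorem Ne.coimpE_neg : Ne Γ rf (coimp φ ψ) → Nf Γ rf ψ → Ne Γ rf φ :=
  fun ⟨d, hd, hn, hN⟩ ⟨e, he, hm⟩ => ⟨.coimpE_neg d e, Set.union_subset hd he,
    isNormal_of_majorPremise_eq_some rfl rfl hN (by simpa [premises] using ⟨hn, hm⟩),
    rfl, by simp [EndsInIntro], by simp [EndsInExplosion, explosionPremise]⟩

theorem Ne.andE₁_pos : Ne Γ pf (and φ ψ) → Ne Γ pf φ :=
  fun ⟨d, hd, hn, hN⟩ => ⟨.andE₁_pos d, hd,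
    isNormal_of_majorPremise_eq_some rfl rfl hN (by simpa [premises] using hn),
    rfl, by simp [EndsInIntro], by simp [EndsInExplosion, explosionPremise]⟩

theorem Ne.andE₂_pos : Ne Γ pf (and φ ψ) → Ne Γ pf ψ :=
  fun ⟨d, hd, hn, hN⟩ => ⟨.andE₂_pos d, hd,
    isNormal_of_majorPremise_eq_some rfl rfl hN (by simpa [premises] using hn),
    rfl, by simp [EndsInIntro], by simp [EndsInExplosion, explosionPremise]⟩

theorem Ne.coimpE₁_pos : Ne Γ pf (coimp φ ψ) → Ne Γ pf φ :=
  fun ⟨d, hd, hn, hN⟩ => ⟨.coimpE₁_pos d, hd,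
    isNormal_of_majorPremise_eq_some rfl rfl hN (by simpa [premises] using hn),
    rfl, by simp [EndsInIntro], by simp [EndsInExplosion, explosionPremise]⟩

theorem Ne.coimpE₂_pos : Ne Γ pf (coimp φ ψ) → Ne Γ rf ψ :=
  fun ⟨d, hd, hn, hN⟩ => ⟨.coimpE₂_pos d, hd,
    isNormal_of_majorPremise_eq_some rfl rfl hN (by simpa [premises] using hn),
    rfl, by simp [EndsInIntro], by simp [EndsInExplosion, explosionPremise]⟩

theorem Ne.orE₁_neg : Ne Γ rf (or φ ψ) → Ne Γ rf φ :=
  fun ⟨d, hd, hn, hN⟩ => ⟨.orE₁_neg d, hd,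
    isNormal_of_majorPremise_eq_some rfl rfl hN (by simpa [premises] using hn),
    rfl, by simp [EndsInIntro], by simp [EndsInExplosion, explosionPremise]⟩

theorem Ne.orE₂_neg : Ne Γ rf (or φ ψ) → Ne Γ rf ψ :=
  fun ⟨d, hd, hn, hN⟩ => ⟨.orE₂_neg d, hd,
    isNormal_of_majorPremise_eq_some rfl rfl hN (by simpa [premises] using hn),
    rfl, by simp [EndsInIntro], by simp [EndsInExplosion, explosionPremise]⟩

theorem Ne.impE₁_neg : Ne Γ rf (imp φ ψ) → Ne Γ pf φ :=
  fun ⟨d, hd, hn, hN⟩ => ⟨.impE₁_neg d, hd,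
    isNormal_of_majorPremise_eq_some rfl rfl hN (by simpa [premises] using hn),
    rfl, by simp [EndsInIntro], by simp [EndsInExplosion, explosionPremise]⟩

theorem Ne.impE₂_neg : Ne Γ rf (imp φ ψ) → Ne Γ rf ψ :=
  fun ⟨d, hd, hn, hN⟩ => ⟨.impE₂_neg d, hd,
    isNormal_of_majorPremise_eq_some rfl rfl hN (by simpa [premises] using hn),
    rfl, by simp [EndsInIntro], by simp [EndsInExplosion, explosionPremise]⟩

/-- The result is normal but not neutral: segments run on into the minor premises, which may end in
introductions. -/
theorem Nf.orE_pos : Ne Γ pf (or φ ψ) → Nf (insert (pf, φ) Γ) s χ →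
    Nf (insert (pf, ψ) Γ) s χ → Nf Γ s χ :=
  fun ⟨d, hd, hn, hN⟩ ⟨e₁, he₁, hm₁⟩ ⟨e₂, he₂, hm₂⟩ => ⟨.orE_pos 0 0 d e₁ e₂,
    Set.union_subset (Set.union_subset hd (Ctx.diff_subset_leaves he₁))
      (Ctx.diff_subset_leaves he₂),
    isNormal_of_majorPremise_eq_some rfl rfl hN (by simpa [premises] using ⟨hn, hm₁, hm₂⟩)⟩

theorem Nf.andE_neg : Ne Γ rf (and φ ψ) → Nf (insert (rf, φ) Γ) s χ →
    Nf (insert (rf, ψ) Γ) s χ → Nf Γ s χ :=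
  fun ⟨d, hd, hn, hN⟩ ⟨e₁, he₁, hm₁⟩ ⟨e₂, he₂, hm₂⟩ => ⟨.andE_neg 0 0 d e₁ e₂,
    Set.union_subset (Set.union_subset hd (Ctx.diff_subset_leaves he₁))
      (Ctx.diff_subset_leaves he₂),
    isNormal_of_majorPremise_eq_some rfl rfl hN (by simpa [premises] using ⟨hn, hm₁, hm₂⟩)⟩

/-- The context refutes itself: `⊥` has a neutral proof or `⊤` a neutral refutation. -/
def Ctx.Explodes (Γ : Ctx At) : Prop :=
  Ne Γ pf bot ∨ Ne Γ rf top

theorem Ctx.Explodes.mono (h : Γ ⊆ Γ') : Γ.Explodes → Γ'.Explodes :=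
  Or.imp (Ne.mono h) (Ne.mono h)

theorem Ctx.Explodes.nf_of_degree_eq_zero (h : Γ.Explodes) (hφ : φ.degree = 0) : Nf Γ s φ := by
  rcases h with ⟨d, hd, hn, hN⟩ | ⟨d, hd, hn, hN⟩
  · exact ⟨.botE d, hd, isNormal_of_explosionPremise_eq_some rfl rfl hN hφ rfl
      (by simpa [premises] using hn)⟩
  · exact ⟨.topE d, hd, isNormal_of_explosionPremise_eq_some rfl rfl hN hφ rfl
      (by simpa [premises] using hn)⟩

end Rules

/-- Normal form allows explosion only into degree 0, so compound formulas are assembled from such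
conclusions by introductions. Sign and context vary in the induction because introductions mix signs
and discharge hypotheses. -/
theorem Ctx.Explodes.nf (h : Γ.Explodes) : Nf Γ s φ := by
  induction φ generalizing s Γ with
  | atom p => exact h.nf_of_degree_eq_zero rfl
  | bot => exact h.nf_of_degree_eq_zero rfl
  | top => exact h.nf_of_degree_eq_zero rfl
  | and φ ψ ihφ ihψ =>
    cases s
    · exact .andI_pos (ihφ h) (ihψ h)
    · exact .andI₁_neg (ihφ h)
  | or φ ψ ihφ ihψ =>
    cases s
    · exact .orI₁_pos (ihφ h)
    · exact .orI_neg (ihφ h) (ihψ h)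
  | imp φ ψ ihφ ihψ =>
    cases s
    · exact .impI_pos (ihψ (h.mono (Set.subset_insert _ _)))
    · exact .impI_neg (ihφ h) (ihψ h)
  | coimp φ ψ ihφ ihψ =>
    cases s
    · exact .coimpI_pos (ihφ h) (ihψ h)
    · exact .coimpI_neg (ihφ (h.mono (Set.subset_insert _ _)))

/-! ### Case covers and forcing over contexts -/

/-- `P` holds after finitely many case distinctions on neutral derivations. -/
inductive Cov (P : Ctx At → Prop) : Ctx At → Prop
  | ret {Γ : Ctx At} (h : P Γ) : Cov P Γ
  | explode {Γ : Ctx At} (h : Γ.Explodes) : Cov P Γ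
  | orCase {Γ : Ctx At} {φ ψ : Formula At} (h : Ne Γ pf (or φ ψ))
      (h₁ : Cov P (insert (pf, φ) Γ)) (h₂ : Cov P (insert (pf, ψ) Γ)) : Cov P Γ
  | andCase {Γ : Ctx At} {φ ψ : Formula At} (h : Ne Γ rf (and φ ψ))
      (h₁ : Cov P (insert (rf, φ) Γ)) (h₂ : Cov P (insert (rf, ψ) Γ)) : Cov P Γ

namespace Cov

variable {P Q : Ctx At → Prop}

theorem mono (hP : ∀ ⦃Γ Γ'⦄, Γ ⊆ Γ' → P Γ → P Γ') (h : Cov P Γ) (hΓ : Γ ⊆ Γ') : Cov P Γ' := by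
  induction h generalizing Γ' with
  | ret h => exact ret (hP hΓ h)
  | explode h => exact explode (h.mono hΓ)
  | orCase h _ _ ih₁ ih₂ =>
    exact orCase (h.mono hΓ) (ih₁ (Set.insert_subset_insert hΓ)) (ih₂ (Set.insert_subset_insert hΓ))
  | andCase h _ _ ih₁ ih₂ =>
    exact andCase (h.mono hΓ) (ih₁ (Set.insert_subset_insert hΓ))
      (ih₂ (Set.insert_subset_insert hΓ))

/-- Covers compose by grafting: each leaf is replaced by a cover of the larger context reached
there. -/
theorem bind (h : Cov P Γ) (hQ : ∀ Γ', Γ ⊆ Γ' → P Γ' → Cov Q Γ') : Cov Q Γ := by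
  induction h with
  | ret h => exact hQ _ subset_rfl h
  | explode h => exact explode h
  | orCase h _ _ ih₁ ih₂ =>
    exact orCase h (ih₁ fun _ h' => hQ _ ((Set.subset_insert _ _).trans h'))
      (ih₂ fun _ h' => hQ _ ((Set.subset_insert _ _).trans h'))
  | andCase h _ _ ih₁ ih₂ =>
    exact andCase h (ih₁ fun _ h' => hQ _ ((Set.subset_insert _ _).trans h'))
      (ih₂ fun _ h' => hQ _ ((Set.subset_insert _ _).trans h'))

theorem map (h : Cov P Γ) (hQ : ∀ Γ', Γ ⊆ Γ' → P Γ' → Q Γ') : Cov Q Γ :=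
  h.bind fun Γ' hΓ hP => ret (hQ Γ' hΓ hP)

/-- A cover is itself the skeleton of a derivation: its nodes become `E∨(+)` and `E∧(-)` with
neutral major premises. -/
theorem nf (h : Cov (fun Γ => Nf Γ s φ) Γ) : Nf Γ s φ := by
  induction h with
  | ret h => exact h
  | explode h => exact h.nf
  | orCase h _ _ ih₁ ih₂ => exact .orE_pos h ih₁ ih₂
  | andCase h _ _ ih₁ ih₂ => exact .andE_neg h ih₁ ih₂

end Cov

/-- Beth-style semantics in the model whose worlds are the contexts: support of the proof
(`pf`) or of the refutation (`rf`) of a formula. -/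
def Forces : Formula At → Mode → Ctx At → Prop
  -- Normal rather than neutral derivability, so that atoms are local: `Cov.nf` absorbs a cover.
  | .atom p, s, Γ => Nf Γ s (atom p)
  | .bot, pf, Γ => Cov (fun _ => False) Γ
  | .bot, rf, _ => True
  | .top, pf, _ => True
  | .top, rf, Γ => Cov (fun _ => False) Γ
  | .and φ ψ, pf, Γ => Forces φ pf Γ ∧ Forces ψ pf Γ
  | .and φ ψ, rf, Γ => Cov (fun Γ' => Forces φ rf Γ' ∨ Forces ψ rf Γ') Γ
  | .or φ ψ, pf, Γ => Cov (fun Γ' => Forces φ pf Γ' ∨ Forces ψ pf Γ') Γ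
  | .or φ ψ, rf, Γ => Forces φ rf Γ ∧ Forces ψ rf Γ
  | .imp φ ψ, pf, Γ => ∀ Γ', Γ ⊆ Γ' → Forces φ pf Γ' → Forces ψ pf Γ'
  | .imp φ ψ, rf, Γ => Forces φ pf Γ ∧ Forces ψ rf Γ
  | .coimp φ ψ, pf, Γ => Forces φ pf Γ ∧ Forces ψ rf Γ
  | .coimp φ ψ, rf, Γ => ∀ Γ', Γ ⊆ Γ' → Forces ψ rf Γ' → Forces φ rf Γ'

theorem Forces.mono (hΓ : Γ ⊆ Γ') (h : Forces φ s Γ) : Forces φ s Γ' := by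
  induction φ generalizing s Γ Γ' with
  | atom p => exact Nf.mono hΓ h
  | bot =>
    cases s
    · exact Cov.mono (fun _ _ _ h => h) h hΓ
    · trivial
  | top =>
    cases s
    · trivial
    · exact Cov.mono (fun _ _ _ h => h) h hΓ
  | and φ ψ ihφ ihψ =>
    cases s
    · exact ⟨ihφ hΓ h.1, ihψ hΓ h.2⟩
    · exact Cov.mono (fun _ _ h' => Or.imp (ihφ h') (ihψ h')) h hΓ
  | or φ ψ ihφ ihψ =>
    cases s
    · exact Cov.mono (fun _ _ h' => Or.imp (ihφ h') (ihψ h')) h hΓ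
    · exact ⟨ihφ hΓ h.1, ihψ hΓ h.2⟩
  | imp φ ψ ihφ ihψ =>
    cases s
    · exact fun Δ hΔ => h Δ (hΓ.trans hΔ)
    · exact ⟨ihφ hΓ h.1, ihψ hΓ h.2⟩
  | coimp φ ψ ihφ ihψ =>
    cases s
    · exact ⟨ihφ hΓ h.1, ihψ hΓ h.2⟩
    · exact fun Δ hΔ => h Δ (hΓ.trans hΔ)

/-- This locality is what makes the eliminations with arbitrary conclusion, and explosion, sound.
Clauses defined by `Cov` flatten a cover of covers; the others push the cover to the components. -/
theorem Forces.of_cov (h : Cov (Forces φ s) Γ) : Forces φ s Γ := by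
  induction φ generalizing s Γ with
  | atom p => exact Cov.nf h
  | bot =>
    cases s
    · exact Cov.bind h fun _ _ h' => h'
    · trivial
  | top =>
    cases s
    · trivial
    · exact Cov.bind h fun _ _ h' => h'
  | and φ ψ ihφ ihψ =>
    cases s
    · exact ⟨ihφ (h.map fun _ _ h' => h'.1), ihψ (h.map fun _ _ h' => h'.2)⟩
    · exact Cov.bind h fun _ _ h' => h'
  | or φ ψ ihφ ihψ =>
    cases s
    · exact Cov.bind h fun _ _ h' => h'
    · exact ⟨ihφ (h.map fun _ _ h' => h'.1), ihψ (h.map fun _ _ h' => h'.2)⟩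
  | imp φ ψ ihφ ihψ =>
    cases s
    · intro Δ hΔ hφ
      -- The cover is first transported to `Δ`; at each of its leaves the antecedent is still forced
      -- by persistence.
      exact ihψ ((h.mono (fun _ _ => Forces.mono) hΔ).map fun Δ' hΔ' h' =>
        h' Δ' subset_rfl (hφ.mono hΔ'))
    · exact ⟨ihφ (h.map fun _ _ h' => h'.1), ihψ (h.map fun _ _ h' => h'.2)⟩
  | coimp φ ψ ihφ ihψ =>
    cases s
    · exact ⟨ihφ (h.map fun _ _ h' => h'.1), ihψ (h.map fun _ _ h' => h'.2)⟩
    · intro Δ hΔ hψ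
      exact ihφ ((h.mono (fun _ _ => Forces.mono) hΔ).map fun Δ' hΔ' h' =>
        h' Δ' subset_rfl (hψ.mono hΔ'))

/-- Both directions must be proved together: reflecting an implication reifies its antecedent, and
reifying it reflects the antecedent as a fresh hypothesis. Co-implication behaves dually. -/
theorem Forces.reflect_reify (φ : Formula At) (s : Mode) (Γ : Ctx At) :
    (Ne Γ s φ → Forces φ s Γ) ∧ (Forces φ s Γ → Nf Γ s φ) := by
  induction φ generalizing s Γ with
  | atom p => exact ⟨Ne.nf, id⟩
  | bot =>
    cases s
    · exact ⟨fun h => .explode (.inl h), fun h => (Cov.map h fun _ _ h' => h'.elim).nf⟩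
    · exact ⟨fun _ => trivial, fun _ => .botI_neg⟩
  | top =>
    cases s
    · exact ⟨fun _ => trivial, fun _ => .topI_pos⟩
    · exact ⟨fun h => .explode (.inr h), fun h => (Cov.map h fun _ _ h' => h'.elim).nf⟩
  | and φ ψ ihφ ihψ =>
    cases s
    · exact ⟨fun h => ⟨(ihφ _ _).1 h.andE₁_pos, (ihψ _ _).1 h.andE₂_pos⟩,
        fun h => .andI_pos ((ihφ _ _).2 h.1) ((ihψ _ _).2 h.2)⟩
    -- The neutral refutation supplies one case split; in each branch the new hypothesis is neutral
    -- and is reflected.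
    · exact ⟨fun h => .andCase h (.ret (.inl ((ihφ _ _).1 (.hyp (Set.mem_insert _ _)))))
          (.ret (.inr ((ihψ _ _).1 (.hyp (Set.mem_insert _ _))))),
        fun h => (Cov.map h fun _ _ h' => h'.elim (fun h' => .andI₁_neg ((ihφ _ _).2 h'))
          fun h' => .andI₂_neg ((ihψ _ _).2 h')).nf⟩
  | or φ ψ ihφ ihψ =>
    cases s
    · exact ⟨fun h => .orCase h (.ret (.inl ((ihφ _ _).1 (.hyp (Set.mem_insert _ _)))))
          (.ret (.inr ((ihψ _ _).1 (.hyp (Set.mem_insert _ _))))),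
        fun h => (Cov.map h fun _ _ h' => h'.elim (fun h' => .orI₁_pos ((ihφ _ _).2 h'))
          fun h' => .orI₂_pos ((ihψ _ _).2 h')).nf⟩
    · exact ⟨fun h => ⟨(ihφ _ _).1 h.orE₁_neg, (ihψ _ _).1 h.orE₂_neg⟩,
        fun h => .orI_neg ((ihφ _ _).2 h.1) ((ihψ _ _).2 h.2)⟩
  | imp φ ψ ihφ ihψ =>
    cases s
    · exact ⟨fun h Δ hΔ hφ => (ihψ _ _).1 ((h.mono hΔ).impE_pos ((ihφ _ _).2 hφ)),
        fun h => .impI_pos ((ihψ _ _).2 (h _ (Set.subset_insert _ _)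
          ((ihφ _ _).1 (.hyp (Set.mem_insert _ _)))))⟩
    · exact ⟨fun h => ⟨(ihφ _ _).1 h.impE₁_neg, (ihψ _ _).1 h.impE₂_neg⟩,
        fun h => .impI_neg ((ihφ _ _).2 h.1) ((ihψ _ _).2 h.2)⟩
  | coimp φ ψ ihφ ihψ =>
    cases s
    · exact ⟨fun h => ⟨(ihφ _ _).1 h.coimpE₁_pos, (ihψ _ _).1 h.coimpE₂_pos⟩,
        fun h => .coimpI_pos ((ihφ _ _).2 h.1) ((ihψ _ _).2 h.2)⟩
    · exact ⟨fun h Δ hΔ hψ => (ihφ _ _).1 ((h.mono hΔ).coimpE_neg ((ihψ _ _).2 hψ)),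
        fun h => .coimpI_neg ((ihφ _ _).2 (h _ (Set.subset_insert _ _)
          ((ihψ _ _).1 (.hyp (Set.mem_insert _ _)))))⟩

/-- Every hypothesis in `S` is forced at `Γ`. -/
def ForcesAll (S : Set (Mode × Formula At × ℕ)) (Γ : Ctx At) : Prop :=
  ∀ h ∈ S, Forces h.2.1 h.1 Γ

theorem ForcesAll.insert {S : Set (Mode × Formula At × ℕ)} {n : ℕ}
    (h : ForcesAll (S \ {(s, φ, n)}) Γ) (hΓ : Γ ⊆ Γ') (hφ : Forces φ s Γ') : ForcesAll S Γ' := by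
  intro x hx
  by_cases hxe : x = (s, φ, n)
  · subst hxe; exact hφ
  · exact (h x ⟨hx, hxe⟩).mono hΓ

theorem ForcesAll.left {S T : Set (Mode × Formula At × ℕ)} (h : ForcesAll (S ∪ T) Γ) :
    ForcesAll S Γ :=
  fun x hx => h x (Or.inl hx)

theorem ForcesAll.right {S T : Set (Mode × Formula At × ℕ)} (h : ForcesAll (S ∪ T) Γ) :
    ForcesAll T Γ :=
  fun x hx => h x (Or.inr hx)

/-- Soundness. Introductions and the other eliminations match the forcing clauses directly; only
`E∨(+)`, `E∧(-)` and the explosions need locality. -/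
theorem Deriv.forces (d : Deriv s φ) (h : ForcesAll d.openHyps Γ) : Forces φ s Γ := by
  induction d generalizing Γ with
  | hyp s φ n => exact h _ rfl
  | topI_pos => trivial
  | botI_neg => trivial
  | impI_pos n d ih => exact fun Δ hΔ hφ => ih (h.insert hΔ hφ)
  | coimpI_neg n d ih => exact fun Δ hΔ hφ => ih (h.insert hΔ hφ)
  | impE_pos d e ihd ihe => exact ihd h.left _ subset_rfl (ihe h.right)
  | coimpE_neg d e ihd ihe => exact ihd h.left _ subset_rfl (ihe h.right)
  | orI₁_pos d ih => exact .ret (.inl (ih h))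
  | orI₂_pos d ih => exact .ret (.inr (ih h))
  | andI₁_neg d ih => exact .ret (.inl (ih h))
  | andI₂_neg d ih => exact .ret (.inr (ih h))
  | orE_pos n m d e₁ e₂ ihd ih₁ ih₂ =>
    exact .of_cov (Cov.map (ihd h.left.left) fun Δ hΔ h' => h'.elim
      (fun h' => ih₁ (h.left.right.insert hΔ h')) fun h' => ih₂ (h.right.insert hΔ h'))
  | andE_neg n m d e₁ e₂ ihd ih₁ ih₂ =>
    exact .of_cov (Cov.map (ihd h.left.left) fun Δ hΔ h' => h'.elim
      (fun h' => ih₁ (h.left.right.insert hΔ h')) fun h' => ih₂ (h.right.insert hΔ h'))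
  | andI_pos d e ihd ihe => exact ⟨ihd h.left, ihe h.right⟩
  | coimpI_pos d e ihd ihe => exact ⟨ihd h.left, ihe h.right⟩
  | orI_neg d e ihd ihe => exact ⟨ihd h.left, ihe h.right⟩
  | impI_neg d e ihd ihe => exact ⟨ihd h.left, ihe h.right⟩
  | andE₁_pos d ih => exact (ih h).1
  | andE₂_pos d ih => exact (ih h).2
  | coimpE₁_pos d ih => exact (ih h).1
  | coimpE₂_pos d ih => exact (ih h).2
  | orE₁_neg d ih => exact (ih h).1
  | orE₂_neg d ih => exact (ih h).2
  | impE₁_neg d ih => exact (ih h).1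
  | impE₂_neg d ih => exact (ih h).2
  | botE d ih => exact .of_cov (Cov.map (ih h) fun _ _ h' => h'.elim)
  | topE d ih => exact .of_cov (Cov.map (ih h) fun _ _ h' => h'.elim)

/-! ### Normalization by evaluation -/

theorem Derives.exists_isNormal {Γ Δ : Set (Formula At)} (h : Derives Γ Δ s φ) :
    ∃ d : Deriv s φ, d.DependsOn Γ Δ ∧ d.IsNormal := by
  obtain ⟨d, hΓ, hΔ⟩ := h
  -- The world at which to evaluate: the assumptions signed `pf`, the counterassumptions signed
  -- `rf`.
  let Θ : Ctx At := {h | (h.1 = pf ∧ h.2 ∈ Γ) ∨ (h.1 = rf ∧ h.2 ∈ Δ)}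
  have hd : ForcesAll d.openHyps Θ := by
    rintro ⟨t, ψ, n⟩ hx
    refine (Forces.reflect_reify ψ t Θ).1 (.hyp ?_)
    cases t
    · exact Or.inl ⟨rfl, hΓ ⟨n, hx⟩⟩
    · exact Or.inr ⟨rfl, hΔ ⟨n, hx⟩⟩
  -- Evaluate the given derivation at `Θ`, then reify its value.
  obtain ⟨e, he, hn⟩ := (Forces.reflect_reify φ s Θ).2 (d.forces hd)
  refine ⟨e, ⟨?_, ?_⟩, hn⟩
  · rintro ψ ⟨n, hx⟩
    simpa [Θ] using (he hx).1
  · rintro ψ ⟨n, hx⟩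
    simpa [Θ] using (he hx).1

end N2IntStar

theorem mainTheorem7 {At : Type*} :
    (∀ (s : N2IntStar.Mode) (φ : N2IntStar.Formula At) (d : N2IntStar.Deriv s φ),
      d.IsNormal → d.HasSubformulaProperty) ∧
    (∀ (Γ Δ : Set (N2IntStar.Formula At)) (s : N2IntStar.Mode) (φ : N2IntStar.Formula At),
      N2IntStar.Derives Γ Δ s φ →
        ∃ d : N2IntStar.Deriv s φ,
          d.DependsOn Γ Δ ∧ d.IsNormal ∧ d.HasSubformulaProperty) := by
  exact ⟨fun _ _ _ hd => hd.hasSubformulaProperty, fun _ _ _ _ h =>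
    let ⟨d, hd, hn⟩ := h.exists_isNormal
    ⟨d, hd, hn, hn.hasSubformulaProperty⟩⟩
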